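/- Let $\mathbb F$ be a finite field, $I$ a finite index set, and $\mathcal C\subseteq\mathbb F^I$ a linear code. Let $\mathcal G=(V,E)$ be a finite connected graph (in particular $V\neq\emptyset$; loops and parallel edges are allowed). For $v\in V$ let $E(v)$ be the set of edges incident with $v$, and for $W\subseteq V$ let $N(W)$ be the set of vertices adjacent to some vertex of $W$. Trees are finite; a single vertex is a tree. *Realizations.* Given a map $\omega:I\to V$, a graphical model on $(\mathcal G,\omega)$ consists of a finite-dimensional $\mathbb F$-vector space $\mathcal S_e$ for each $e\in E$ and a subspace $C_v\subseteq \mathbb F^{\omega^{-1}(v)}\oplus\bigoplus_{e\in E(v)}\mathcal S_e$ for each $v\in V$. Its full behavior $\mathfrak B$ is the space of all $\big((x_i)_{i\in I},(s_e)_{e\in E}\big)\in\mathbb F^I\oplus\bigoplus_{e\in E}\mathcal S_e$ such that $\big((x_i)_{i\in\omega^{-1}(v)},(s_e)_{e\in E(v)}\big)\in C_v$ for every $v\in V$. The model is a realization of $\mathcal C$ on $\mathcal G$ (extending $(\mathcal G,\omega)$) if $\mathfrak B$ projects onto each $C_v$ and onto each $\mathcal S_e$, and its projection to $\mathbb F^I$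 equals $\mathcal C$. Let $\kappa(\mathcal C;\mathcal G,\omega)$ be the minimum of $\max_{v\in V}\dim C_v$ over all realizations of $\mathcal C$ extending $(\mathcal G,\omega)$, let $\kappa(\mathcal C;\mathcal G)=\min_{\omega}\kappa(\mathcal C;\mathcal G,\omega)$ over all maps $\omega:I\to V$, and let the treewidth of the code be $\kappa_{\mathrm{tree}}(\mathcal C)=\min_T\kappa(\mathcal C;T)$ over all trees $T$. *Widths of graphs.* Consider pairs $(T,\beta)$ with $T$ a tree and $\beta:V(T)\to 2^{V}$ such that $\bigcup_z\beta(z)=V$ and $\beta(x)\cap\beta(y)\subseteq\beta(z)$ whenever $z$ lies on the path between $x$ and $y$ in $T$. Such a pair is a vertex-cut tree of $\mathcal G$ if for each $z\in V(T)$, with $T_1,\dots,T_\delta$ the components of $T-z$ and $V_i=\big(\bigcup_{x\in V(T_i)}\beta(x)\big)\setminus\beta(z)$, the sets $\beta(z),V_1,\dots,V_\delta$ (some possibly empty) are pairwise disjoint, have union $V$, and satisfy $N(V_i)\subseteq V_i\cup\beta(z)$ for all $i$. It is a tree decomposition of $\mathcal G$ if any two adjacent vertices of $\mathcal G$ lie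 together in some $\beta(z)$. The vc-treewidth $\kappa_{\text{vc-tree}}(\mathcal G)$ is the minimum of $\max_z|\beta(z)|$ over all vertex-cut trees $(T,\beta)$ of $\mathcal G$, and the treewidth $\kappa_{\mathrm{tree}}(\mathcal G)$ is the minimum of $\max_z|\beta(z)|-1$ over all tree decompositions $(T,\beta)$ of $\mathcal G$. Then $$\kappa(\mathcal C;\mathcal G)\ \ge\ \frac{\kappa_{\mathrm{tree}}(\mathcal C)}{\kappa_{\text{vc-tree}}(\mathcal G)}\ \ge\ \frac{\kappa_{\mathrm{tree}}(\mathcal C)}{\kappa_{\mathrm{tree}}(\mathcal G)+1}.$$ -/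

import Mathlib

open scoped Graph

namespace CodeGraph

universe u v w x

/-! ### Connected graphs

Graphs are Mathlib's multigraphs `Graph α β` (loops and parallel edges are allowed), with vertex set
`V(G)` and edge set `E(G)`. Trees are connected acyclic simple graphs; a tree `T : SimpleGraph V` is
regarded as the multigraph `Graph.ofSimpleGraph T` when a code is realized on it. -/

/-- A (multi)graph is connected if it has a vertex and any two vertices are joined by a path. -/
def IsConnected {α : Type w} {β : Type x} (G : Graph α β) : Prop :=
  V(G).Nonempty ∧ ∀ a ∈ V(G), ∀ b ∈ V(G), Relation.ReflTransGen G.Adj a b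

/-- `E(v)`: the edges of `G` that are incident with the vertex `v`. -/
abbrev IncEdge {α : Type w} {β : Type x} (G : Graph α β) (v : V(G)) : Type x :=
  {e : E(G) // G.Inc e.1 v.1}

/-- `N(W)`: the set of vertices that have a neighbour in `W`. -/
def neighborhood {α : Type w} {β : Type x} (G : Graph α β) (W : Set α) : Set α :=
  {a | ∃ b ∈ W, G.Adj b a}

/-! ### Graphical models and realizations of codes

A code over `F` with index set `I` is a subspace `C : Submodule F (I → F)`. -/

/-- A graphical model on the graph `G` with index mapping `ω : I → V(G)`: a (finite-dimensional)
state space for each edge, and for each vertex `v` a local constraint code, which is a subspace of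
`F^{ω⁻¹(v)} ⊕ ⨁_{e ∈ E(v)} S_e`. -/
structure GraphicalModel (F : Type u) [Field F] {I : Type v} {α : Type w} {β : Type x}
    (G : Graph α β) (ω : I → V(G)) where
  /-- the state spaces -/
  S : E(G) → Type (max u v)
  [addCommGroup : ∀ e, AddCommGroup (S e)]
  [module : ∀ e, Module F (S e)]
  [finiteDimensional : ∀ e, FiniteDimensional F (S e)]
  /-- the local constraint codes -/
  constraint : ∀ v : V(G),
    Submodule F (({i : I // ω i = v} → F) × (∀ e : IncEdge G v, S e.1))

attribute [instance] GraphicalModel.addCommGroup GraphicalModel.module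
  GraphicalModel.finiteDimensional

namespace GraphicalModel

variable {F : Type u} [Field F] {I : Type v} {α : Type w} {β : Type x} {G : Graph α β}
  {ω : I → V(G)}

/-- A global configuration assigns a value to each symbol variable and to each state variable. -/
abbrev GlobalConfig (Γ : GraphicalModel F G ω) : Type (max u v x) :=
  (I → F) × (∀ e : E(G), Γ.S e)

/-- The local configuration at the vertex `v` of a global configuration. -/
def localConfig (Γ : GraphicalModel F G ω) (v : V(G)) :
    Γ.GlobalConfig →ₗ[F] ({i : I // ω i = v} → F) × (∀ e : IncEdge G v, Γ.S e.1) where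
  toFun b := (fun i => b.1 i.1, fun e => b.2 e.1)
  map_add' _ _ := rfl
  map_smul' _ _ := rfl

/-- The state at the edge `e` of a global configuration. -/
def stateAt (Γ : GraphicalModel F G ω) (e : E(G)) : Γ.GlobalConfig →ₗ[F] Γ.S e where
  toFun b := b.2 e
  map_add' _ _ := rfl
  map_smul' _ _ := rfl

/-- The full behavior: the global configurations that satisfy all the local constraints. -/
def behavior (Γ : GraphicalModel F G ω) : Submodule F Γ.GlobalConfig :=
  ⨅ v : V(G), (Γ.constraint v).comap (Γ.localConfig v)

/-- A model is essential if the full behavior projects onto each local constraint code and onto each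
state space. -/
def IsEssential (Γ : GraphicalModel F G ω) : Prop :=
  (∀ v : V(G), Γ.behavior.map (Γ.localConfig v) = Γ.constraint v) ∧
    ∀ e : E(G), Γ.behavior.map (Γ.stateAt e) = ⊤

/-- `Γ` is a realization of the code `C` (on `G`, extending the graph decomposition `(G, ω)`). -/
def IsRealization (Γ : GraphicalModel F G ω) (C : Submodule F (I → F)) : Prop :=
  Γ.IsEssential ∧ Γ.behavior.map (LinearMap.fst F (I → F) (∀ e : E(G), Γ.S e)) = C

/-- The `κ`-complexity: the maximum of the dimensions of the local constraint codes. -/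
noncomputable def complexity (Γ : GraphicalModel F G ω) : ℕ :=
  ⨆ v : V(G), Module.finrank F (Γ.constraint v)

end GraphicalModel

section Width

variable {F : Type u} [Field F] {I : Type v} {α : Type w} {β : Type x}

/-- `κ(C; G, ω)`: the least `κ`-complexity of a realization of `C` that extends `(G, ω)`. -/
noncomputable def widthOn (C : Submodule F (I → F)) (G : Graph α β) (ω : I → V(G)) : ℕ :=
  sInf {k | ∃ Γ : GraphicalModel F G ω, Γ.IsRealization C ∧ Γ.complexity = k}

/-- The `G`-width `κ(C; G)` of `C`: the minimum of `κ(C; G, ω)` over all index mappings `ω`. -/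
noncomputable def graphWidth (C : Submodule F (I → F)) (G : Graph α β) : ℕ :=
  ⨅ ω : I → V(G), widthOn C G ω

/-- The treewidth `κ_tree(C)` of the code `C`: the minimum of `κ(C; T)` over all finite trees `T`. -/
noncomputable def codeTreewidth (C : Submodule F (I → F)) : ℕ :=
  sInf {k | ∃ (V : Type) (_ : Finite V) (T : SimpleGraph V),
    T.IsTree ∧ graphWidth C (Graph.ofSimpleGraph T) = k}

/-- On a connected graph, every index mapping extends to a realization of `C`, so the minima defining
`κ(C; G, ω)`, `κ(C; G)` and `κ_tree(C)` are taken over nonempty sets. -/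
theorem exists_isRealization [Finite I] (C : Submodule F (I → F)) {G : Graph α β} (hG : IsConnected G)
    (ω : I → V(G)) : ∃ Γ : GraphicalModel F G ω, Γ.IsRealization C := by
  let f : ∀ v : V(G), C →ₗ[F] ({i : I // ω i = v} → F) × (IncEdge G v → C) := fun v =>
    { toFun := fun c => (fun i => c.1 i.1, fun _ => c)
      map_add' := fun _ _ => rfl
      map_smul' := fun _ _ => rfl }
  let g : C →ₗ[F] (I → F) × (E(G) → C) :=
    { toFun := fun c => (c.1, fun _ => c)
      map_add' := fun _ _ => rfl
      map_smul' := fun _ _ => rfl }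
  let Γ : GraphicalModel F G ω := { S := fun _ => C, constraint := fun v => LinearMap.range (f v) }
  have hB : Γ.behavior = LinearMap.range g := by
    ext b
    constructor
    · intro hb
      have hb' : ∀ v : V(G), ∃ c : C, f v c = Γ.localConfig v b := fun v =>
        (Submodule.mem_iInf _).1 hb v
      choose c hc using hb'
      have h2 : ∀ (v : V(G)) (e : IncEdge G v), c v = b.2 e.1 := fun v e =>
        congrFun (congrArg Prod.snd (hc v)) e
      obtain ⟨a, ha⟩ := hG.1
      have key : ∀ a', Relation.ReflTransGen G.Adj a a' → ∀ h : a' ∈ V(G), c ⟨a', h⟩ = c ⟨a, ha⟩ := by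
        intro a' h
        induction h with
        | refl => intro _; rfl
        | tail _ hadj ih =>
          intro h
          obtain ⟨e, he⟩ := hadj
          rw [← ih he.left_mem, h2 ⟨_, h⟩ ⟨⟨e, he.edge_mem⟩, he.inc_right⟩,
            h2 ⟨_, he.left_mem⟩ ⟨⟨e, he.edge_mem⟩, he.inc_left⟩]
      refine ⟨c ⟨a, ha⟩, Prod.ext ?_ ?_⟩
      · funext i
        have h1 := congrFun (congrArg Prod.fst (hc (ω i))) ⟨i, rfl⟩
        have h3 := key (ω i).1 (hG.2 a ha _ (ω i).2) (ω i).2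
        exact (congrArg (fun d : C => d.1 i) h3.symm).trans h1
      · funext e
        obtain ⟨y, z, he⟩ := G.exists_isLink_of_mem_edgeSet e.2
        have h3 := key y (hG.2 a ha _ he.left_mem) he.left_mem
        exact h3.symm.trans (h2 ⟨y, he.left_mem⟩ ⟨e, he.inc_left⟩)
    · rintro ⟨c, rfl⟩
      exact (Submodule.mem_iInf _).2 fun v => ⟨c, rfl⟩
  refine ⟨Γ, ⟨fun v => ?_, fun e => ?_⟩, ?_⟩
  · rw [hB]
    ext y
    constructor
    · rintro ⟨_, ⟨c, rfl⟩, rfl⟩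
      exact ⟨c, rfl⟩
    · rintro ⟨c, rfl⟩
      exact ⟨g c, ⟨c, rfl⟩, rfl⟩
  · rw [hB, eq_top_iff]
    intro c _
    exact ⟨g c, ⟨c, rfl⟩, rfl⟩
  · rw [hB]
    ext y
    constructor
    · rintro ⟨_, ⟨c, rfl⟩, rfl⟩
      exact c.2
    · intro hy
      exact ⟨g ⟨y, hy⟩, ⟨_, rfl⟩, rfl⟩

end Width

/-! ### Vertex-cut trees and tree decompositions of a graph -/

section Decompositions

variable {α : Type w} {β : Type x}

/-- `(V₀, (Vᵢ)ᵢ)` is a star partition of `V(G)`: these sets, some of which may be empty, are pairwise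
disjoint and cover `V(G)`, and `N(Vᵢ) ⊆ Vᵢ ∪ V₀` for all `i`. -/
structure IsStarPartition (G : Graph α β) {ι : Type*} (V₀ : Set α) (W : ι → Set α) : Prop where
  disjoint_center : ∀ i, Disjoint V₀ (W i)
  pairwise_disjoint : ∀ i j, i ≠ j → Disjoint (W i) (W j)
  cover : V₀ ∪ ⋃ i, W i = V(G)
  neighborhood_subset : ∀ i, neighborhood G (W i) ⊆ W i ∪ V₀

/-- `(T, b)`, with `T` a tree and `b` a map to sets of vertices of `G`, is a vertex-cut tree of `G`. -/
structure IsVertexCutTree (G : Graph α β) {V : Type} (T : SimpleGraph V) (b : V → Set α) : Prop where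
  isTree : T.IsTree
  cover : ⋃ z, b z = V(G)
  inter_subset : ∀ (y y' z : V) (p : T.Walk y y'), p.IsPath → z ∈ p.support → b y ∩ b y' ⊆ b z
  /-- The index `c` runs over the components of `T - z`. -/
  starPartition : ∀ z : V, IsStarPartition G (b z)
    (fun c : (T.induce {z}ᶜ).ConnectedComponent => (⋃ y ∈ c.supp, b y.1) \ b z)

/-- `(T, b)`, with `T` a tree and `b` a map to sets of vertices of `G`, is a tree decomposition of
`G`. -/
structure IsTreeDecomposition (G : Graph α β) {V : Type} (T : SimpleGraph V) (b : V → Set α) :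
    Prop where
  isTree : T.IsTree
  cover : ⋃ z, b z = V(G)
  inter_subset : ∀ (y y' z : V) (p : T.Walk y y'), p.IsPath → z ∈ p.support → b y ∩ b y' ⊆ b z
  adj : ∀ a a', G.Adj a a' → ∃ z, a ∈ b z ∧ a' ∈ b z

/-- `max_z |b(z)|`. -/
noncomputable def maxBag {V : Type} (b : V → Set α) : ℕ := ⨆ z, (b z).ncard

/-- `κ_vc-tree(G)`: the least vc-width `max_z |b(z)|` of a vertex-cut tree of `G`. -/
noncomputable def vcTreewidth (G : Graph α β) : ℕ :=
  sInf {k | ∃ (V : Type) (_ : Finite V) (T : SimpleGraph V) (b : V → Set α),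
    IsVertexCutTree G T b ∧ maxBag b = k}

/-- `κ_tree(G)`: the least width `max_z |b(z)| - 1` of a tree decomposition of `G`. (If `G` has a
vertex, then `max_z |b(z)| ≥ 1`, so that the subtraction is not truncated.) -/
noncomputable def graphTreewidth (G : Graph α β) : ℕ :=
  sInf {k | ∃ (V : Type) (_ : Finite V) (T : SimpleGraph V) (b : V → Set α),
    IsTreeDecomposition G T b ∧ maxBag b - 1 = k}

/-- The one-vertex tree with the bag `V(G)` is a vertex-cut tree and a tree decomposition, so the
minima defining `κ_vc-tree(G)` and `κ_tree(G)` are taken over nonempty sets. -/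
theorem isVertexCutTree_and_isTreeDecomposition_unit (G : Graph α β) :
    IsVertexCutTree G (⊥ : SimpleGraph Unit) (fun _ => V(G)) ∧
      IsTreeDecomposition G (⊥ : SimpleGraph Unit) (fun _ => V(G)) := by
  have hT : (⊥ : SimpleGraph Unit).IsTree := SimpleGraph.IsTree.of_subsingleton
  have hc : ⋃ _ : Unit, V(G) = V(G) := Set.iUnion_const _
  refine ⟨⟨hT, hc, fun _ _ _ _ _ _ => by simp, fun z => ?_⟩, hT, hc, fun _ _ _ _ _ _ => by simp,
    fun a a' h => ⟨(), h.left_mem, h.symm.left_mem⟩⟩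
  have : IsEmpty ((⊥ : SimpleGraph Unit).induce {z}ᶜ).ConnectedComponent :=
    ⟨fun c => c.ind fun y => y.2 rfl⟩
  exact ⟨fun c => isEmptyElim c, fun c => isEmptyElim c, by simp, fun c => isEmptyElim c⟩

end Decompositions

end CodeGraph

/-! Take an optimal realization of `C` on `G` with index mapping `ω`, an optimal vertex-cut tree
`(T, b)`, and for each index `i` a node `τ i` of `T` with `ω i ∈ b (τ i)`. On `T` with `τ` use the
canonical realization `treeModel`: the state of a codeword at an edge `e` is its class modulo the
sums of codewords that each live on one side of `e`. That this model realizes `C`, with no spurious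
behavior, is the gluing statement `exists_glue`.

Its constraint code at `z` is the image of `C` under `treeLocalMap`, which kills every codeword
living on one component of `T - z`. In the model on `G`, a configuration in the behavior that is
locally zero on the bag `b z` falls apart into members of the behavior living on the pieces `V_i` of
the star partition at `z` (`exists_split_of_starPartition`), so its codeword is killed as well. The
constraint code at `z` therefore has dimension at most that of the product of the constraint codes
at the vertices of `b z`, hence at most `|b z|` times the complexity of the model on `G`.

The second inequality holds because every tree decomposition is a vertex-cut tree. -/

namespace CodeGraph

universe u v w x

/-! ### Cross sections of a code along a tree, and gluing of codewords -/

section Trees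

variable {F : Type u} [Field F] {I : Type v} {V : Type w}

/-- The codewords of `C` that vanish at all the indices mapped outside `A`. -/
def crossSection (C : Submodule F (I → F)) (ω : I → V) (A : Set V) : Submodule F C where
  carrier := {c | ∀ i, ω i ∉ A → c.1 i = 0}
  add_mem' {a b} ha hb i hi := by
    have h1 := ha i hi
    have h2 := hb i hi
    simp [h1, h2]
  zero_mem' _ _ := rfl
  smul_mem' r a ha i hi := by
    have h1 := ha i hi
    simp [h1]

theorem crossSection_mono (C : Submodule F (I → F)) (ω : I → V) {A B : Set V} (h : A ⊆ B) :
    crossSection C ω A ≤ crossSection C ω B := fun _ hc i hi => hc i fun hA => hi (h hA)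

/-- The sum of the cross sections of `C` at the components of `T - e`. -/
def cutSum (C : Submodule F (I → F)) (T : SimpleGraph V) (ω : I → V) (e : Sym2 V) :
    Submodule F C :=
  ⨆ K : (T.deleteEdges {e}).ConnectedComponent, crossSection C ω K.supp

theorem reachable_deleteEdges_of_notMem_support {T : SimpleGraph V} {a b u : V} (p : T.Walk a b)
    (hu : u ∉ p.support) (y : V) : (T.deleteEdges {s(u, y)}).Reachable a b :=
  ⟨p.toDeleteEdge s(u, y) fun h => hu (p.fst_mem_support_of_mem_edges h)⟩

/-- A set whose points are joined by walks avoiding `u` lies on one side of each edge at `u`. -/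
theorem crossSection_le_cutSum (C : Submodule F (I → F)) {T : SimpleGraph V} (ω : I → V)
    {A : Set V} {u a : V} (hA : ∀ b ∈ A, ∃ p : T.Walk b a, u ∉ p.support) (y : V) :
    crossSection C ω A ≤ cutSum C T ω s(u, y) := by
  refine le_trans (crossSection_mono C ω fun b hb => ?_)
    (le_iSup (fun K : (T.deleteEdges {s(u, y)}).ConnectedComponent => crossSection C ω K.supp)
      (SimpleGraph.connectedComponentMk _ a))
  obtain ⟨p, hp⟩ := hA b hb
  exact SimpleGraph.ConnectedComponent.sound (reachable_deleteEdges_of_notMem_support p hp y)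

/-- A walk inside the component `K` of `T - e` never meets `u`, since otherwise `u` would belong to
`K`. -/
theorem crossSection_supp_le_cutSum (C : Submodule F (I → F)) {T : SimpleGraph V} (ω : I → V)
    {e : Sym2 V} (K : (T.deleteEdges {e}).ConnectedComponent) {u : V} (hu : u ∉ K.supp) (y : V) :
    crossSection C ω K.supp ≤ cutSum C T ω s(u, y) := by
  induction K using SimpleGraph.ConnectedComponent.ind with
  | h a =>
    refine crossSection_le_cutSum C ω (a := a) (fun b hb => ?_) y
    obtain ⟨p⟩ := SimpleGraph.ConnectedComponent.exact hb
    refine ⟨p.mapLe (SimpleGraph.deleteEdges_le _), fun h => hu ?_⟩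
    rw [SimpleGraph.Walk.support_mapLe_eq_support] at h
    classical
    exact SimpleGraph.ConnectedComponent.sound ⟨p.dropUntil u h⟩

theorem crossSection_component_le_cutSum (C : Submodule F (I → F)) {T : SimpleGraph V} (ω : I → V)
    {u : V} (K : (T.induce {u}ᶜ).ConnectedComponent) (y : V) :
    crossSection C ω (Subtype.val '' K.supp) ≤ cutSum C T ω s(u, y) := by
  induction K using SimpleGraph.ConnectedComponent.ind with
  | h a =>
    refine crossSection_le_cutSum C ω (a := a.1) ?_ y
    rintro _ ⟨b, hb, rfl⟩
    obtain ⟨p⟩ := SimpleGraph.ConnectedComponent.exact hb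
    let f := (SimpleGraph.Embedding.induce (G := T) {u}ᶜ).toHom
    refine ⟨p.map f, fun h => ?_⟩
    have h' : u ∈ (p.map f).support := h
    rw [SimpleGraph.Walk.support_map, List.mem_map] at h'
    obtain ⟨x, _, hx⟩ := h'
    exact x.2 hx

/-- An element of `cutSum` at the edge `vw` is the sum of a codeword supported on the side of `v`
and one that is supported on the rest. -/
theorem cutSum_decomposition {C : Submodule F (I → F)} {T : SimpleGraph V} {ω : I → V} {e : Sym2 V}
    {c : C} (hc : c ∈ cutSum C T ω e) (v : V) :
    ∃ a ∈ crossSection C ω ((T.deleteEdges {e}).connectedComponentMk v).supp,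
      c - a ∈ crossSection C ω {v}ᶜ ∧ ∀ y, c - a ∈ cutSum C T ω s(v, y) := by
  let P : (T.deleteEdges {e}).ConnectedComponent := (T.deleteEdges {e}).connectedComponentMk v
  let R : Submodule F C :=
    ⨆ K : {K : (T.deleteEdges {e}).ConnectedComponent // K ≠ P}, crossSection C ω K.1.supp
  have hle : cutSum C T ω e ≤ crossSection C ω P.supp ⊔ R := by
    refine iSup_le fun K => ?_
    by_cases hK : K = P
    · rw [hK]
      exact le_sup_left
    · exact le_sup_of_le_right (le_iSup (fun K : {K // K ≠ P} => crossSection C ω K.1.supp) ⟨K, hK⟩)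
  obtain ⟨a, ha, b, hb, rfl⟩ := Submodule.mem_sup.1 (hle hc)
  have hv : ∀ K : {K : (T.deleteEdges {e}).ConnectedComponent // K ≠ P}, v ∉ K.1.supp :=
    fun K h => K.2 h.symm
  refine ⟨a, ha, ?_, fun y => ?_⟩ <;> rw [add_sub_cancel_left]
  · refine (iSup_le fun K => ?_ : R ≤ _) hb
    exact crossSection_mono C ω fun x hx hxv => hv K (hxv ▸ hx)
  · exact (iSup_le fun K => crossSection_supp_le_cutSum C ω K.1 (hv K) y : R ≤ _) hb

/-- Codewords at the vertices of a tree that are compatible along the edges come from one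
codeword. -/
theorem exists_glue [Finite V] {C : Submodule F (I → F)} {T : SimpleGraph V} (hT : T.IsTree)
    {ω : I → V} (c : V → C) (hc : ∀ v w, T.Adj v w → c v - c w ∈ cutSum C T ω s(v, w)) :
    ∃ d : C, ∀ v, (∀ i, ω i = v → d.1 i = (c v).1 i) ∧
      ∀ w, T.Adj v w → d - c v ∈ cutSum C T ω s(v, w) := by
  -- Subtrees on which a common codeword `d` exists. The congruence is demanded at every edge of `T`
  -- at `v`, including those that leave `W`; this is what allows `W` to grow.
  let Q : Set (Set V) := {W | W.Nonempty ∧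
    (∀ u ∈ W, ∀ u' ∈ W, ∃ p : T.Walk u u', ∀ x ∈ p.support, x ∈ W) ∧
    ∃ d : C, ∀ v ∈ W, (∀ i, ω i = v → d.1 i = (c v).1 i) ∧
      ∀ w, T.Adj v w → d - c v ∈ cutSum C T ω s(v, w)}
  have hQ : Q.Nonempty := by
    obtain ⟨r⟩ := hT.1.nonempty
    refine ⟨{r}, ⟨r, rfl⟩, ?_, c r, ?_⟩
    · rintro _ rfl _ rfl
      exact ⟨.nil, by simp⟩
    · rintro _ rfl
      exact ⟨fun _ _ => rfl, fun w _ => by simp⟩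
  obtain ⟨W, hW⟩ := (Set.toFinite Q).exists_maximal hQ
  obtain ⟨⟨r, hr⟩, hconn, d, hd⟩ := hW.1
  by_cases huniv : ∀ v, v ∈ W
  · exact ⟨d, fun v => hd v (huniv v)⟩
  exfalso
  push Not at huniv
  obtain ⟨t, ht⟩ := huniv
  obtain ⟨p⟩ := hT.1.preconnected r t
  obtain ⟨δ, -, hw, hv⟩ := p.exists_boundary_dart W hr ht
  obtain ⟨⟨w, v⟩, hadj⟩ := δ
  simp only at hw hv hadj
  have hbr : ¬ (T.deleteEdges {s(v, w)}).Reachable w v := by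
    have := SimpleGraph.isAcyclic_iff_forall_adj_isBridge.1 hT.2 hadj
    rwa [SimpleGraph.isBridge_iff, Sym2.eq_swap] at this
  -- `W` is connected and misses `v`, so it lies entirely on the side of `w` of the bridge `vw`.
  have hside : ∀ u ∈ W, u ∉ ((T.deleteEdges {s(v, w)}).connectedComponentMk v).supp := by
    intro u hu h
    obtain ⟨q, hq⟩ := hconn w hw u hu
    exact hbr ((reachable_deleteEdges_of_notMem_support q (fun h => hv (hq v h)) w).trans
      (SimpleGraph.ConnectedComponent.exact h))
  have hmem : c v - d ∈ cutSum C T ω s(v, w) := by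
    have h1 := hc v w hadj.symm
    have h2 := (hd w hw).2 v hadj
    rw [Sym2.eq_swap] at h2
    simpa using sub_mem h1 h2
  -- Only the part `a` of `c v - d` on the side of `v` is added to `d`. It is invisible to `W`, and
  -- `d + a` differs from `c v` by a codeword on the far side, which is invisible to `v`.
  obtain ⟨a, ha, hb1, hb2⟩ := cutSum_decomposition hmem v
  have hins : insert v W ∈ Q := by
    refine ⟨⟨v, Set.mem_insert _ _⟩, ?_, d + a, ?_⟩
    · rintro u (rfl | hu) u' (rfl | hu')
      · exact ⟨.nil, by simp⟩
      · obtain ⟨q, hq⟩ := hconn w hw u' hu'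
        refine ⟨.cons hadj.symm q, fun x hx => ?_⟩
        rw [SimpleGraph.Walk.support_cons, List.mem_cons] at hx
        exact hx.imp id (hq x)
      · obtain ⟨q, hq⟩ := hconn u hu w hw
        refine ⟨q.concat hadj, fun x hx => ?_⟩
        rw [SimpleGraph.Walk.support_concat, List.mem_append,
          List.mem_singleton] at hx
        exact hx.symm.imp id (hq x)
      · obtain ⟨q, hq⟩ := hconn u hu u' hu'
        exact ⟨q, fun x hx => Or.inr (hq x hx)⟩
    · rintro u (rfl | hu)
      · refine ⟨fun i hi => ?_, fun y _ => ?_⟩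
        · have h := hb1 i (fun h => h hi)
          simp only [Submodule.coe_sub, Pi.sub_apply, Submodule.coe_add, Pi.add_apply] at h ⊢
          linear_combination -h
        · have h := neg_mem (hb2 y)
          convert h using 1
          abel
      · refine ⟨fun i hi => ?_, fun y hy => ?_⟩
        · have h := ha i (hi ▸ hside u hu)
          rw [Submodule.coe_add, Pi.add_apply, h, add_zero, (hd u hu).1 i hi]
        · have h := add_mem ((hd u hu).2 y hy)
            (crossSection_supp_le_cutSum C ω _ (hside u hu) y ha)
          convert h using 1
          abel
  exact hv (hW.2 hins (Set.subset_insert _ _) (Set.mem_insert _ _))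

end Trees

/-! ### The canonical realization on a tree -/

section TreeModel

variable {F : Type u} [Field F] {I : Type v} {V : Type}

/-- The index mapping into the vertices of `Graph.ofSimpleGraph T` given by `ω : I → V`. -/
def treeIndex (T : SimpleGraph V) (ω : I → V) (i : I) : V(Graph.ofSimpleGraph T) :=
  ⟨ω i, Set.mem_univ _⟩

/-- The local configuration of a codeword at the vertex `z` of a tree, where the state at an edge
`e` is the class of the codeword modulo `cutSum`. -/
def treeLocalMap (C : Submodule F (I → F)) (T : SimpleGraph V) (ω : I → V)
    (z : V(Graph.ofSimpleGraph T)) :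
    C →ₗ[F] ({i : I // treeIndex T ω i = z} → F) ×
      (∀ e : IncEdge (Graph.ofSimpleGraph T) z, C ⧸ cutSum C T ω e.1.1) where
  toFun c := (fun i => c.1 i.1, fun e => (cutSum C T ω e.1.1).mkQ c)
  map_add' _ _ := rfl
  map_smul' _ _ := rfl

/-- The graphical model on a tree whose state space at an edge `e` is `C` modulo `cutSum` at `e`. -/
def treeModel [Finite I] (C : Submodule F (I → F)) (T : SimpleGraph V) (ω : I → V) :
    GraphicalModel F (Graph.ofSimpleGraph T) (treeIndex T ω) where
  S e := C ⧸ cutSum C T ω e.1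
  constraint z := LinearMap.range (treeLocalMap C T ω z)

theorem isRealization_treeModel [Finite I] [Finite V] (C : Submodule F (I → F)) {T : SimpleGraph V}
    (hT : T.IsTree) (ω : I → V) : (treeModel C T ω).IsRealization C := by
  let g : C →ₗ[F] (treeModel C T ω).GlobalConfig :=
    { toFun := fun c => (c.1, fun e => (cutSum C T ω e.1).mkQ c)
      map_add' := fun _ _ => rfl
      map_smul' := fun _ _ => rfl }
  have hB : (treeModel C T ω).behavior = LinearMap.range g := by
    ext b
    constructor
    · intro hb
      have hb' : ∀ z : V(Graph.ofSimpleGraph T), ∃ c : C,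
          treeLocalMap C T ω z c = (treeModel C T ω).localConfig z b := fun z =>
        (Submodule.mem_iInf _).1 hb z
      choose c hc using hb'
      have hedge : ∀ (v w : V) (h : T.Adj v w),
          (cutSum C T ω s(v, w)).mkQ (c ⟨v, Set.mem_univ _⟩) = b.2 ⟨s(v, w), h⟩ := fun v w h =>
        congrFun (congrArg Prod.snd (hc ⟨v, Set.mem_univ _⟩)) ⟨⟨s(v, w), h⟩, ⟨w, rfl, h⟩⟩
      -- Local preimages at the two ends of an edge have the same state there, so they are congruent
      -- modulo `cutSum`: the hypothesis for gluing.
      have hcomp : ∀ v w, T.Adj v w → c ⟨v, Set.mem_univ _⟩ - c ⟨w, Set.mem_univ _⟩ ∈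
          cutSum C T ω s(v, w) := by
        intro v w h
        have h1 := hedge v w h
        have h2 : (cutSum C T ω s(v, w)).mkQ (c ⟨w, Set.mem_univ _⟩) = b.2 ⟨s(v, w), h⟩ :=
          congrFun (congrArg Prod.snd (hc ⟨w, Set.mem_univ _⟩))
            ⟨⟨s(v, w), h⟩, ⟨v, Sym2.eq_swap, h⟩⟩
        exact (Submodule.Quotient.eq _).1 (h1.trans h2.symm)
      obtain ⟨d, hd⟩ := exists_glue hT (fun v => c ⟨v, Set.mem_univ _⟩) hcomp
      refine ⟨d, Prod.ext ?_ ?_⟩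
      · funext i
        have h1 := congrFun (congrArg Prod.fst (hc (treeIndex T ω i))) ⟨i, rfl⟩
        exact ((hd (ω i)).1 i rfl).trans h1
      · funext e
        obtain ⟨e, he⟩ := e
        induction e with
        | h v w =>
          exact ((Submodule.Quotient.eq _).2 ((hd v).2 w he)).trans (hedge v w he)
    · rintro ⟨c, rfl⟩
      exact (Submodule.mem_iInf _).2 fun z => ⟨c, rfl⟩
  refine ⟨⟨fun z => ?_, fun e => ?_⟩, ?_⟩
  · rw [hB]
    ext y
    constructor
    · rintro ⟨_, ⟨c, rfl⟩, rfl⟩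
      exact ⟨c, rfl⟩
    · rintro ⟨c, rfl⟩
      exact ⟨g c, ⟨c, rfl⟩, rfl⟩
  · rw [hB, eq_top_iff]
    intro s _
    obtain ⟨c, rfl⟩ := Submodule.mkQ_surjective _ s
    exact ⟨g c, ⟨c, rfl⟩, rfl⟩
  · rw [hB]
    ext y
    constructor
    · rintro ⟨_, ⟨c, rfl⟩, rfl⟩
      exact c.2
    · intro hy
      exact ⟨g ⟨y, hy⟩, ⟨_, rfl⟩, rfl⟩

/-- No index at `z` is mapped into `K`, and `K`, being connected in `T - z`, lies on one side of
each edge at `z`. -/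
theorem treeLocalMap_eq_zero (C : Submodule F (I → F)) (T : SimpleGraph V) (ω : I → V)
    (z : V(Graph.ofSimpleGraph T)) (K : (T.induce {z.1}ᶜ).ConnectedComponent) (c : C)
    (hc : c ∈ crossSection C ω (Subtype.val '' K.supp)) : treeLocalMap C T ω z c = 0 := by
  refine Prod.ext (funext fun i => hc i.1 ?_) (funext fun e => ?_)
  · rintro ⟨x, _, hx⟩
    exact x.2 (hx.trans (congrArg Subtype.val i.2))
  · obtain ⟨⟨e, he⟩, y, hy, hy'⟩ := e
    obtain rfl : e = s(z.1, y) := hy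
    exact (Submodule.Quotient.mk_eq_zero _).2 (crossSection_component_le_cutSum C ω K y hc)

end TreeModel

/-! ### Splitting a behavior along a star partition, and the rank bound -/

section StarPartition

variable {F : Type u} [Field F] {I : Type v} {α : Type w} {β : Type x} {G : Graph α β}
  {ω : I → V(G)}

namespace GraphicalModel

theorem mem_behavior {Γ : GraphicalModel F G ω} {b : Γ.GlobalConfig} :
    b ∈ Γ.behavior ↔ ∀ v, Γ.localConfig v b ∈ Γ.constraint v := Submodule.mem_iInf _

/-- A global configuration that vanishes at the center of a star partition splits along the
partition. -/
theorem exists_split_of_starPartition (Γ : GraphicalModel F G ω) {ι : Type*} [Fintype ι]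
    {V₀ : Set α} {W : ι → Set α} (hW : IsStarPartition G V₀ W) {b : Γ.GlobalConfig}
    (hb : b ∈ Γ.behavior) (h0 : ∀ v : V(G), v.1 ∈ V₀ → Γ.localConfig v b = 0) :
    ∃ y : ι → Γ.GlobalConfig, (∀ k, y k ∈ Γ.behavior) ∧
      (∀ k i, (ω i).1 ∉ W k → (y k).1 i = 0) ∧ b.1 = ∑ k, (y k).1 := by
  classical
  -- Keep the symbols located in `W k` and the states on all edges that meet `W k`, including those
  -- leading to the center.
  let y : ι → Γ.GlobalConfig := fun k =>
    (fun i => if (ω i).1 ∈ W k then b.1 i else 0,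
      fun e => if ∃ a ∈ W k, G.Inc e.1 a then b.2 e else 0)
  refine ⟨y, fun k => mem_behavior.2 fun v => ?_, fun k i hi => if_neg hi, funext fun i => ?_⟩
  · by_cases hv : v.1 ∈ W k
    · have : Γ.localConfig v (y k) = Γ.localConfig v b := by
        refine Prod.ext (funext fun i => if_pos ?_) (funext fun e => if_pos ⟨v.1, hv, e.2⟩)
        rw [i.2]
        exact hv
      rw [this]
      exact mem_behavior.1 hb v
    · have : Γ.localConfig v (y k) = 0 := by
        refine Prod.ext (funext fun i => if_neg ?_) (funext fun e => ?_)
        · rw [i.2]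
          exact hv
        · refine ite_eq_right_iff.2 ?_
          rintro ⟨a, ha, hea⟩
          obtain ⟨a', hlink⟩ := hea
          have hva : v.1 = a' := e.2.eq_of_isLink_of_ne_left hlink fun h => hv (h ▸ ha)
          -- A vertex outside `W k` on an edge meeting `W k` must be in the center, where `b` is
          -- zero; so the kept state is zero too.
          have hN : v.1 ∈ W k ∪ V₀ := hW.neighborhood_subset k ⟨a, ha, e.1.1, hva ▸ hlink⟩
          exact congrFun (congrArg Prod.snd (h0 v (hN.resolve_left hv))) e
      rw [this]
      exact zero_mem _
  · rw [Finset.sum_apply]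
    by_cases hi : (ω i).1 ∈ V₀
    · have h1 : b.1 i = 0 := congrFun (congrArg Prod.fst (h0 (ω i) hi)) ⟨i, rfl⟩
      rw [h1]
      refine (Finset.sum_eq_zero fun k _ => if_neg ?_).symm
      exact fun h => Set.disjoint_left.1 (hW.disjoint_center k) hi h
    · have hmem : (ω i).1 ∈ V₀ ∪ ⋃ k, W k := by
        rw [hW.cover]
        exact (ω i).2
      obtain ⟨k, hk⟩ := Set.mem_iUnion.1 (hmem.resolve_left hi)
      rw [Finset.sum_eq_single k (fun l _ hl => if_neg fun h =>
        Set.disjoint_left.1 (hW.pairwise_disjoint l k hl) h hk) (by simp)]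
      exact (if_pos hk).symm

theorem finrank_constraint_le_complexity [Finite V(G)] (Γ : GraphicalModel F G ω) (v : V(G)) :
    Module.finrank F (Γ.constraint v) ≤ Γ.complexity :=
  le_ciSup (f := fun v => Module.finrank F (Γ.constraint v)) (Set.finite_range _).bddAbove v

/-- A linear map on `C` that kills the cross sections of `C` along a star partition has rank at most
the total dimension of the constraint codes at the center. -/
theorem finrank_range_le_of_starPartition [Finite I] [Finite V(G)] [Finite E(G)]
    {Γ : GraphicalModel F G ω} {C : Submodule F (I → F)} (hΓ : Γ.IsRealization C)
    {ι : Type*} [Finite ι] {V₀ : Set α} {W : ι → Set α} (hW : IsStarPartition G V₀ W)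
    {M : Type*} [AddCommGroup M] [Module F M] (φ : C →ₗ[F] M)
    (hφ : ∀ k (c : C), (∀ i, (ω i).1 ∉ W k → c.1 i = 0) → φ c = 0) :
    Module.finrank F (LinearMap.range φ) ≤ V₀.ncard * Γ.complexity := by
  cases nonempty_fintype ι
  cases nonempty_fintype I
  cases nonempty_fintype V(G)
  cases nonempty_fintype E(G)
  classical
  have hC : ∀ b ∈ Γ.behavior, b.1 ∈ C := fun b hb => hΓ.2 ▸ Submodule.mem_map_of_mem hb
  let h : Γ.behavior →ₗ[F] C :=
    (LinearMap.fst F (I → F) (∀ e : E(G), Γ.S e)).restrict hC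
  have hsurj : Function.Surjective h := by
    intro c
    have hc : c.1 ∈ Γ.behavior.map (LinearMap.fst F (I → F) (∀ e : E(G), Γ.S e)) := hΓ.2 ▸ c.2
    obtain ⟨b, hb, hbc⟩ := hc
    exact ⟨⟨b, hb⟩, Subtype.ext hbc⟩
  let ev : ∀ v : {v : V(G) // v.1 ∈ V₀}, Γ.behavior →ₗ[F] Γ.constraint v.1 := fun v =>
    (Γ.localConfig v.1).restrict fun b hb => mem_behavior.1 hb v.1
  let g : Γ.behavior →ₗ[F] ∀ v : {v : V(G) // v.1 ∈ V₀}, Γ.constraint v.1 := LinearMap.pi ev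
  -- The kernel of evaluation at the center consists of configurations that split, and `φ` kills the
  -- codeword of each summand. Rank-nullity on the behavior then gives `rank φ = rank (φ ∘ₗ h) ≤
  -- rank g`.
  have hker : LinearMap.ker g ≤ LinearMap.ker (φ ∘ₗ h) := by
    rintro ⟨b, hb⟩ hg
    have hg0 : ∀ v : V(G), v.1 ∈ V₀ → Γ.localConfig v b = 0 := fun v hv =>
      congrArg Subtype.val (congrFun hg ⟨v, hv⟩)
    obtain ⟨y, hy, hyW, hsum⟩ := Γ.exists_split_of_starPartition hW hb hg0
    have hh : h ⟨b, hb⟩ = ∑ k, h ⟨y k, hy k⟩ := by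
      refine Subtype.ext ?_
      rw [AddSubmonoidClass.coe_finsetSum]
      exact hsum
    rw [LinearMap.mem_ker, LinearMap.comp_apply, hh, map_sum]
    exact Finset.sum_eq_zero fun k _ => hφ k _ (hyW k)
  have h1 := LinearMap.finrank_range_add_finrank_ker g
  have h2 := LinearMap.finrank_range_add_finrank_ker (φ ∘ₗ h)
  have h3 := Submodule.finrank_mono hker
  have h4 : LinearMap.range (φ ∘ₗ h) = LinearMap.range φ :=
    LinearMap.range_comp_of_range_eq_top _ (LinearMap.range_eq_top.2 hsurj)
  rw [h4] at h2
  have hcenter : V₀.Finite :=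
    (Set.toFinite V(G)).subset (hW.cover ▸ Set.subset_union_left)
  have := hcenter.to_subtype
  calc Module.finrank F (LinearMap.range φ) ≤ Module.finrank F (LinearMap.range g) := by omega
    _ ≤ Module.finrank F (∀ v : {v : V(G) // v.1 ∈ V₀}, Γ.constraint v.1) :=
      Submodule.finrank_le _
    _ = ∑ v : {v : V(G) // v.1 ∈ V₀}, Module.finrank F (Γ.constraint v.1) :=
      Module.finrank_pi_fintype F
    _ ≤ ∑ _v : {v : V(G) // v.1 ∈ V₀}, Γ.complexity :=
      Finset.sum_le_sum fun v _ => Γ.finrank_constraint_le_complexity v.1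
    _ = Nat.card {v : V(G) // v.1 ∈ V₀} * Γ.complexity := by
      rw [Finset.sum_const, Finset.card_univ, smul_eq_mul, Nat.card_eq_fintype_card]
    _ ≤ V₀.ncard * Γ.complexity := by
      refine Nat.mul_le_mul_right _ ?_
      rw [← Nat.card_coe_set_eq]
      exact Nat.card_le_card_of_injective (fun v => (⟨v.1.1, v.2⟩ : V₀))
        fun v v' h => Subtype.ext (Subtype.ext (congrArg (fun a : V₀ => a.1) h))

theorem finrank_constraint_le_of_starPartition [Finite I] [Finite V(G)] [Finite E(G)]
    {Γ : GraphicalModel F G ω} {C : Submodule F (I → F)} (hΓ : Γ.IsRealization C)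
    {ι : Type*} [Finite ι] {V₀ : Set α} {W : ι → Set α} (hW : IsStarPartition G V₀ W)
    {α' β' : Type*} {G' : Graph α' β'} {ω' : I → V(G')} (Γ' : GraphicalModel F G' ω') (v : V(G'))
    (φ : C →ₗ[F] ({i : I // ω' i = v} → F) × (∀ e : IncEdge G' v, Γ'.S e.1))
    (hφ : ∀ k (c : C), (∀ i, (ω i).1 ∉ W k → c.1 i = 0) → φ c = 0)
    (hrange : Γ'.constraint v = LinearMap.range φ) :
    Module.finrank F (Γ'.constraint v) ≤ V₀.ncard * Γ.complexity := by
  rw [hrange]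
  exact finrank_range_le_of_starPartition hΓ hW φ hφ

end GraphicalModel

end StarPartition

/-! ### Tree decompositions as vertex-cut trees -/

section Decompositions

variable {α : Type w} {β : Type x} {G : Graph α β} {V : Type} {T : SimpleGraph V} {b : V → Set α}

/-- A path between two components of `T - z` passes through `z`. -/
theorem mem_support_of_component_ne {z : V} {c c' : (T.induce {z}ᶜ).ConnectedComponent}
    (hcc : c ≠ c') {y y' : ↥({z}ᶜ : Set V)} (hy : y ∈ c.supp) (hy' : y' ∈ c'.supp)
    (p : T.Walk y.1 y'.1) : z ∈ p.support := by
  by_contra hz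
  have hp : ∀ x ∈ p.support, x ∈ ({z}ᶜ : Set V) := fun x hx hxz => hz (hxz ▸ hx)
  exact hcc (hy.symm.trans ((SimpleGraph.ConnectedComponent.sound ⟨p.induce _ hp⟩).trans hy'))

/-- Paths between different components of `T - z` pass through `z`, so bags from different
components meet only inside `b z`. A bag containing both ends of an edge that avoids `b z` at one
end therefore lies in the component of that end. -/
theorem IsTreeDecomposition.isVertexCutTree (h : IsTreeDecomposition G T b) :
    IsVertexCutTree G T b := by
  have key : ∀ (z : V) (c c' : (T.induce {z}ᶜ).ConnectedComponent), c ≠ c' →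
      ∀ y ∈ c.supp, ∀ y' ∈ c'.supp, b y.1 ∩ b y'.1 ⊆ b z := by
    intro z c c' hcc y hy y' hy'
    obtain ⟨p, hp⟩ := (h.isTree.1.preconnected y.1 y'.1).exists_isPath
    exact h.inter_subset _ _ _ p hp (mem_support_of_component_ne hcc hy hy' p)
  refine ⟨h.isTree, h.cover, h.inter_subset, fun z => ⟨fun c => Set.disjoint_sdiff_right, ?_, ?_, ?_⟩⟩
  · intro c c' hcc
    rw [Set.disjoint_left]
    rintro a ⟨ha, haz⟩ ⟨ha', -⟩
    simp only [Set.mem_iUnion] at ha ha'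
    obtain ⟨y, hy, hay⟩ := ha
    obtain ⟨y', hy', hay'⟩ := ha'
    exact haz (key z c c' hcc y hy y' hy' ⟨hay, hay'⟩)
  · rw [← h.cover]
    refine subset_antisymm (Set.union_subset (Set.subset_iUnion _ _) ?_) fun a ha => ?_
    · refine Set.iUnion_subset fun c => Set.sdiff_subset.trans ?_
      exact Set.iUnion₂_subset fun y _ => Set.subset_iUnion b y.1
    · by_cases haz : a ∈ b z
      · exact Or.inl haz
      · obtain ⟨x, hx⟩ := Set.mem_iUnion.1 ha
        have hxz : x ∈ ({z}ᶜ : Set V) := fun h => haz (h ▸ hx)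
        refine Or.inr (Set.mem_iUnion.2 ⟨(T.induce {z}ᶜ).connectedComponentMk ⟨x, hxz⟩, ?_, haz⟩)
        exact Set.mem_iUnion₂.2 ⟨⟨x, hxz⟩, rfl, hx⟩
  · rintro c a' ⟨a, ⟨ha, haz⟩, hadj⟩
    obtain ⟨y, hy, hay⟩ := Set.mem_iUnion₂.1 ha
    obtain ⟨x, hx, hx'⟩ := h.adj a a' hadj
    by_cases haz' : a' ∈ b z
    · exact Or.inr haz'
    · have hxz : x ∈ ({z}ᶜ : Set V) := fun hxz => haz (hxz ▸ hx)
      refine Or.inl ⟨Set.mem_iUnion₂.2 ⟨⟨x, hxz⟩, ?_, hx'⟩, haz'⟩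
      by_contra hne
      exact haz (key z c _ (fun h => hne h.symm) y hy ⟨x, hxz⟩ rfl ⟨hay, hx⟩)

theorem ncard_le_maxBag [Finite V] (b : V → Set α) (z : V) :
    (b z).ncard ≤ maxBag b :=
  le_ciSup (f := fun z => (b z).ncard) (Set.finite_range _).bddAbove z

theorem exists_isVertexCutTree_maxBag_eq (G : Graph α β) :
    ∃ (V : Type) (_ : Finite V) (T : SimpleGraph V) (b : V → Set α),
      IsVertexCutTree G T b ∧ maxBag b = vcTreewidth G :=
  Nat.sInf_mem (s := {k | ∃ (V : Type) (_ : Finite V) (T : SimpleGraph V) (b : V → Set α),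
    IsVertexCutTree G T b ∧ maxBag b = k})
    ⟨_, Unit, inferInstance, ⊥, _, (isVertexCutTree_and_isTreeDecomposition_unit G).1, rfl⟩

theorem vcTreewidth_pos (hV : V(G).Finite) (hne : V(G).Nonempty) : 0 < vcTreewidth G := by
  obtain ⟨V, _, T, b, h, hb⟩ := exists_isVertexCutTree_maxBag_eq G
  obtain ⟨a, ha⟩ := hne
  rw [← h.cover] at ha hV
  obtain ⟨z, hz⟩ := Set.mem_iUnion.1 ha
  rw [← hb]
  refine lt_of_lt_of_le ?_ (ncard_le_maxBag b z)
  exact (Set.ncard_pos (hV.subset (Set.subset_iUnion b z))).2 ⟨a, hz⟩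

theorem vcTreewidth_le (G : Graph α β) : vcTreewidth G ≤ graphTreewidth G + 1 := by
  obtain ⟨V, hfin, T, b, h, hb⟩ :=
    Nat.sInf_mem (s := {k | ∃ (V : Type) (_ : Finite V) (T : SimpleGraph V) (b : V → Set α),
      IsTreeDecomposition G T b ∧ maxBag b - 1 = k})
      ⟨_, Unit, inferInstance, ⊥, _, (isVertexCutTree_and_isTreeDecomposition_unit G).2, rfl⟩
  have h1 : vcTreewidth G ≤ maxBag b := Nat.sInf_le ⟨V, hfin, T, b, h.isVertexCutTree, rfl⟩
  change maxBag b - 1 = graphTreewidth G at hb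
  -- Truncation of the subtraction is harmless: `maxBag b ≤ (maxBag b - 1) + 1` always holds.
  omega

end Decompositions

/-! ### Comparison of the widths -/

section Main

variable {F : Type u} [Field F] {I : Type v} {α : Type w} {β : Type x}

theorem exists_isRealization_complexity_eq [Finite I] (C : Submodule F (I → F)) {G : Graph α β}
    (hG : IsConnected G) : ∃ (ω : I → V(G)) (Γ : GraphicalModel F G ω),
      Γ.IsRealization C ∧ Γ.complexity = graphWidth C G := by
  have : Nonempty V(G) := hG.1.to_subtype
  obtain ⟨ω, hω⟩ : graphWidth C G ∈ Set.range fun ω : I → V(G) => widthOn C G ω :=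
    Nat.sInf_mem (Set.range_nonempty _)
  obtain ⟨Γ₀, hΓ₀⟩ := exists_isRealization C hG ω
  obtain ⟨Γ, hΓ, hk⟩ := Nat.sInf_mem
    (s := {k | ∃ Γ : GraphicalModel F G ω, Γ.IsRealization C ∧ Γ.complexity = k})
    ⟨_, Γ₀, hΓ₀, rfl⟩
  exact ⟨ω, Γ, hΓ, hk.trans hω⟩

theorem codeTreewidth_le_complexity {C : Submodule F (I → F)} {V : Type} [Finite V]
    {T : SimpleGraph V} (hT : T.IsTree) {ω : I → V(Graph.ofSimpleGraph T)}
    {Γ : GraphicalModel F (Graph.ofSimpleGraph T) ω} (hΓ : Γ.IsRealization C) :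
    codeTreewidth C ≤ Γ.complexity :=
  calc codeTreewidth C ≤ graphWidth C (Graph.ofSimpleGraph T) := Nat.sInf_le ⟨V, ‹_›, T, hT, rfl⟩
    _ ≤ widthOn C (Graph.ofSimpleGraph T) ω := ciInf_le (OrderBot.bddBelow _) ω
    _ ≤ Γ.complexity := Nat.sInf_le ⟨Γ, hΓ, rfl⟩

theorem codeTreewidth_le_mul [Finite I] (C : Submodule F (I → F)) {G : Graph α β}
    (hV : V(G).Finite) (hE : E(G).Finite) (hG : IsConnected G) :
    codeTreewidth C ≤ vcTreewidth G * graphWidth C G := by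
  have := hV.to_subtype
  have := hE.to_subtype
  obtain ⟨ω, Γ, hΓ, hk⟩ := exists_isRealization_complexity_eq C hG
  obtain ⟨V, _, T, b, h, hb⟩ := exists_isVertexCutTree_maxBag_eq G
  have hex : ∀ i, ∃ z, (ω i).1 ∈ b z := fun i =>
    Set.mem_iUnion.1 (h.cover.symm.subset (ω i).2)
  choose τ hτ using hex
  have : Nonempty V(Graph.ofSimpleGraph T) := h.isTree.1.nonempty.map fun z => ⟨z, Set.mem_univ _⟩
  refine (codeTreewidth_le_complexity h.isTree (isRealization_treeModel C h.isTree τ)).trans ?_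
  refine ciSup_le fun z => ?_
  rw [← hk, ← hb]
  -- Pieces of `V(G)` are matched with components of `T - z`: if `ω i` is in the piece of `K`, it is
  -- not in `b z`, so `τ i ≠ z`; were `τ i` in another component `K'`, then `ω i` would also be in
  -- the piece of `K'`, against disjointness.
  have hker : ∀ (K : (T.induce {z.1}ᶜ).ConnectedComponent) (c : C),
      (∀ i, (ω i).1 ∉ (⋃ y ∈ K.supp, b y.1) \ b z.1 → c.1 i = 0) →
        treeLocalMap C T τ z c = 0 := by
    refine fun K c hc => treeLocalMap_eq_zero C T τ z K c fun i hi => hc i ?_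
    intro hmem
    have hne : τ i ∈ ({z.1}ᶜ : Set V) := fun hz => hmem.2 ((show τ i = z.1 from hz) ▸ hτ i)
    have hK : (⟨τ i, hne⟩ : ↥({z.1}ᶜ : Set V)) ∉ K.supp := fun h => hi ⟨_, h, rfl⟩
    let K' := (T.induce {z.1}ᶜ).connectedComponentMk ⟨τ i, hne⟩
    refine Set.disjoint_left.1 ((h.starPartition z.1).pairwise_disjoint K K'
      fun heq => hK heq.symm) hmem ⟨?_, hmem.2⟩
    exact Set.mem_iUnion₂.2 ⟨_, rfl, hτ i⟩
  have hrank := GraphicalModel.finrank_constraint_le_of_starPartition hΓ (h.starPartition z.1)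
    (treeModel C T τ) z (treeLocalMap C T τ z) hker rfl
  exact hrank.trans (Nat.mul_le_mul_right _ (ncard_le_maxBag b z.1))

end Main

end CodeGraph

theorem mainTheorem3 {F : Type*} [Field F] [Finite F] {I : Type*} [Finite I]
    (C : Submodule F (I → F)) {α β : Type*} (G : Graph α β)
    (hV : V(G).Finite) (hE : E(G).Finite) (hG : CodeGraph.IsConnected G) :
    (CodeGraph.graphWidth C G : ℚ) ≥
        (CodeGraph.codeTreewidth C : ℚ) / (CodeGraph.vcTreewidth G : ℚ) ∧
      (CodeGraph.codeTreewidth C : ℚ) / (CodeGraph.vcTreewidth G : ℚ) ≥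
        (CodeGraph.codeTreewidth C : ℚ) / ((CodeGraph.graphTreewidth G : ℚ) + 1) := by
  have hpos : (0 : ℚ) < CodeGraph.vcTreewidth G := by
    exact_mod_cast CodeGraph.vcTreewidth_pos hV hG.1
  constructor
  · rw [ge_iff_le, div_le_iff₀' hpos]
    exact_mod_cast CodeGraph.codeTreewidth_le_mul C hV hE hG
  · refine div_le_div_of_nonneg_left (Nat.cast_nonneg _) hpos ?_
    exact_mod_cast CodeGraph.vcTreewidth_le G
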